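/- Work in $\mathrm{ZFC}$. For a cardinal $\theta$, $H(\theta)$ is the set of all $x$ whose transitive closure has cardinality $<\theta$; for a set $X$ and an infinite cardinal $\kappa$, $\mathscr P_\kappa X=\{x\subseteq X : |x|<\kappa\}$. For $\kappa$ regular uncountable, a set $C\subseteq\mathscr P_\kappa X$ is a club if it is $\subseteq$-cofinal in $\mathscr P_\kappa X$ and $\bigcup D\in C$ for every nonempty $D\subseteq C$ with $|D|<\kappa$ that is linearly ordered by $\subseteq$; $S\subseteq\mathscr P_\kappa X$ is stationary if it meets every club in $\mathscr P_\kappa X$. A $(\kappa,X)$-list is a sequence $\langle d_x : x\in\mathscr P_\kappa X\rangle$ with $d_x\subseteq x$ for all $x$. It is $\mu$-slender if for all sufficiently large cardinals $\theta$ there is a club $C\subseteq\mathscr P_\kappa H(\theta)$ such that $d_{M\cap X}\cap y\in M$ for all $M\in C$ and all $y\in M\cap\mathscr P_\mu X$. A cofinal branch of the list is a set $d\subseteq X$ such that for every $x\in\mathscr P_\kappa X$ there is $z\in\mathscr P_\kappa X$ with $z\supseteq x$ and $d\cap x=d_z\cap x$. The principle $\mathsf{SP}(\mu,\kappa,X)$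 says that every $\mu$-slender $(\kappa,X)$-list has a cofinal branch. Let $M\prec (H(\theta),\in)$, $x\in M$ and $d\subseteq x$. The set $d$ is $(\mu,M)$-approximated if for every $z\in M\cap\mathscr P_\mu(x)$ there is $e\in M$ with $d\cap z=e\cap z$; it is $M$-guessed if there is $e\in M$ with $d\cap M=e\cap M$. $M$ is a $\mu$-guessing model for $x$ if every $(\mu,M)$-approximated $d\subseteq x$ is $M$-guessed, and a $\mu$-guessing model if this holds for every $x\in M$. $M$ is a guessing model for sets of size $\omega_1$ if it is an $\omega_1$-guessing model for every $z\in M$ with $|z|=\omega_1$. The principle $\mathsf{GMP}(\omega_1,\omega_2,H(\omega_2))$ says that the set of $\omega_1$-guessing models $M\prec H(\omega_2)$ with $|M|<\omega_2$ is stationary in $\mathscr P_{\omega_2}H(\omega_2)$. **Corollary.** Consider the statement $(\ast)$ for every regular $\theta\ge\omega_2$, the set $$\{M\prec H(\theta) : |M|<\omega_2\text{ and } M\text{ is a guessing model for sets of size }\omega_1\}$$ is stationary in $\mathscr P_{\omega_2}H(\theta)$. If $\mathsf{SP}(\omega_1,\omega_2,H(\omega_2))$ holds, then $(\ast)$ holds,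 and $\mathsf{GMP}(\omega_1,\omega_2,H(\omega_2))$ holds. Moreover, $(\ast)$ and $\mathsf{GMP}(\omega_1,\omega_2,H(\omega_2))$ are equivalent. -/

import Mathlib

universe u

namespace SmallGuessing

open Cardinal

/-! Sets are elements of Mathlib's `ZFSet`; `ZFSet.card x` is the cardinality of the set `x`. -/

lemma exists_rank_eq_of_isTransitive {t : ZFSet.{u}} (ht : t.IsTransitive) {o : Ordinal.{u}}
    (ho : o < t.rank) : ∃ y ∈ t, y.rank = o := by
  have key : ∀ y : ZFSet.{u}, y ∈ t → o ≤ y.rank → ∃ y' ∈ t, y'.rank = o := by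
    intro y
    induction y using ZFSet.inductionOn with
    | _ y ih =>
      intro hy hle
      rcases hle.eq_or_lt with h | h
      · exact ⟨y, hy, h.symm⟩
      · obtain ⟨w, hw, hle'⟩ := ZFSet.lt_rank_iff.1 h
        exact ih w hw (ht.mem_trans hw hy) hle'
  obtain ⟨y, hy, hle⟩ := ZFSet.lt_rank_iff.1 ho
  exact key y hy hle

lemma rank_lt_ord_of_isTransitive {t : ZFSet.{u}} (ht : t.IsTransitive) {θ : Cardinal.{u}}
    (h : t.card < θ) : t.rank < θ.ord := by
  rw [Cardinal.lt_ord]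
  refine lt_of_le_of_lt ?_ h
  choose f hf hr using fun o : Set.Iio t.rank => exists_rank_eq_of_isTransitive ht o.2
  have hinj : Function.Injective (fun o : Set.Iio t.rank => (⟨f o, hf o⟩ : t)) := by
    intro a b hab
    have h1 : f a = f b := congrArg Subtype.val hab
    exact Subtype.ext (by rw [← hr a, ← hr b, h1])
  have h2 := Cardinal.mk_le_of_injective hinj
  rw [ZFSet.cardinalMk_coe_sort, Cardinal.mk_Iio_ordinal] at h2
  exact Cardinal.lift_le.1 h2

/-- `H(θ)`: the set of all `x` whose transitive closure has cardinality less than `θ`,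
i.e. which are contained in a transitive set of cardinality less than `θ`. The restriction to the
level `V_θ` of the cumulative hierarchy only serves to get a set; see `mem_H`. -/
noncomputable def H (θ : Cardinal.{u}) : ZFSet.{u} :=
  (ZFSet.vonNeumann θ.ord).sep fun x => ∃ t : ZFSet.{u}, t.IsTransitive ∧ x ⊆ t ∧ t.card < θ

theorem mem_H {θ : Cardinal.{u}} {x : ZFSet.{u}} :
    x ∈ H θ ↔ ∃ t : ZFSet.{u}, t.IsTransitive ∧ x ⊆ t ∧ t.card < θ := by
  refine ⟨fun h => (ZFSet.mem_sep.1 h).2, fun h => ZFSet.mem_sep.2 ⟨?_, h⟩⟩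
  obtain ⟨t, ht, hxt, hc⟩ := h
  rw [ZFSet.mem_vonNeumann]
  exact (ZFSet.rank_mono hxt).trans_lt (rank_lt_ord_of_isTransitive ht hc)

/-- `𝒫_κ X`: the subsets of `X` of cardinality less than `κ`. -/
def Pk (κ : Cardinal.{u}) (X : ZFSet.{u}) : Set ZFSet.{u} :=
  {x | x ⊆ X ∧ x.card < κ}

/-- `C` is closed and cofinal in `𝒫_κ X`. -/
structure IsClub (κ : Cardinal.{u}) (X : ZFSet.{u}) (C : Set ZFSet.{u}) : Prop where
  subset : C ⊆ Pk κ X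
  closed : ∀ D : ZFSet.{u}, D.Nonempty → (∀ x ∈ D, x ∈ C) → D.card < κ →
    (∀ x ∈ D, ∀ y ∈ D, x ⊆ y ∨ y ⊆ x) → ZFSet.sUnion D ∈ C
  cofinal : ∀ x ∈ Pk κ X, ∃ y ∈ C, x ⊆ y

/-- `S` is a stationary subset of `𝒫_κ X`. -/
def IsStationary (κ : Cardinal.{u}) (X : ZFSet.{u}) (S : Set ZFSet.{u}) : Prop :=
  S ⊆ Pk κ X ∧ ∀ C : Set ZFSet.{u}, IsClub κ X C → (S ∩ C).Nonempty

/-- `⟨d x | x ∈ 𝒫_κ X⟩` is a `(κ, X)`-list (values of `d` outside `𝒫_κ X` are irrelevant). -/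
def IsList (κ : Cardinal.{u}) (X : ZFSet.{u}) (d : ZFSet.{u} → ZFSet.{u}) : Prop :=
  ∀ x ∈ Pk κ X, d x ⊆ x

/-- The list `d` is `μ`-slender: for all sufficiently large cardinals `θ` there is a club of
`M ∈ 𝒫_κ H(θ)` such that `d_{M ∩ X} ∩ y ∈ M` for all `y ∈ M ∩ 𝒫_μ X`. -/
def IsSlender (μ κ : Cardinal.{u}) (X : ZFSet.{u}) (d : ZFSet.{u} → ZFSet.{u}) : Prop :=
  ∃ θ₀ : Cardinal.{u}, ∀ θ : Cardinal.{u}, θ₀ ≤ θ →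
    ∃ C : Set ZFSet.{u}, IsClub κ (H θ) C ∧
      ∀ M ∈ C, ∀ y ∈ M, y ∈ Pk μ X → d (M ∩ X) ∩ y ∈ M

/-- `b ⊆ X` is a cofinal branch of the list `d`. -/
def IsCofinalBranch (κ : Cardinal.{u}) (X : ZFSet.{u}) (d : ZFSet.{u} → ZFSet.{u})
    (b : ZFSet.{u}) : Prop :=
  b ⊆ X ∧ ∀ x ∈ Pk κ X, ∃ z ∈ Pk κ X, x ⊆ z ∧ b ∩ x = d z ∩ x

/-- The slender tree property `SP(μ, κ, X)`. -/
def SP (μ κ : Cardinal.{u}) (X : ZFSet.{u}) : Prop :=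
  ∀ d : ZFSet.{u} → ZFSet.{u}, IsList κ X d → IsSlender μ κ X d →
    ∃ b : ZFSet.{u}, IsCofinalBranch κ X d b

/-- The relation symbols of the language of set theory: one binary symbol. -/
inductive SetRel : ℕ → Type
  | mem : SetRel 2

/-- The first-order language `{∈}` of set theory. -/
def setLang : FirstOrder.Language where
  Functions := fun _ => Empty
  Relations := SetRel

/-- Every set `X` is regarded as the structure `(X, ∈)`. -/
instance setStructure (X : ZFSet.{u}) : setLang.Structure X where
  funMap := fun f _ => f.elim
  RelMap := fun r => match r with
    | SetRel.mem => fun v => (v 0 : ZFSet.{u}) ∈ (v 1 : ZFSet.{u})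

/-- `(M, ∈) ≺ (X, ∈)`: the inclusion map is defined and is an elementary embedding. -/
def IsElementarySub (M X : ZFSet.{u}) : Prop :=
  ∃ j : setLang.ElementaryEmbedding M X, ∀ a : M, (j a : ZFSet.{u}) = a

/-- `d ⊆ x` is `(μ, M)`-approximated. -/
def IsApproximated (μ : Cardinal.{u}) (M x d : ZFSet.{u}) : Prop :=
  ∀ z ∈ M, z ∈ Pk μ x → ∃ e ∈ M, d ∩ z = e ∩ z

/-- `d` is `M`-guessed. -/
def IsGuessed (M d : ZFSet.{u}) : Prop :=
  ∃ e ∈ M, d ∩ M = e ∩ M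

/-- `M ≺ H(θ)` is a `μ`-guessing model for the set `x ∈ M`. -/
def IsGuessingModelFor (μ θ : Cardinal.{u}) (M x : ZFSet.{u}) : Prop :=
  IsElementarySub M (H θ) ∧ x ∈ M ∧
    ∀ d : ZFSet.{u}, d ⊆ x → IsApproximated μ M x d → IsGuessed M d

/-- `M ≺ H(θ)` is a `μ`-guessing model. -/
def IsGuessingModel (μ θ : Cardinal.{u}) (M : ZFSet.{u}) : Prop :=
  IsElementarySub M (H θ) ∧ ∀ x ∈ M, IsGuessingModelFor μ θ M x

/-- `M ≺ H(θ)` is a guessing model (i.e. an `ω₁`-guessing model) for sets of size `ω₁`. -/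
def IsGuessingModelForSizeOmegaOne (θ : Cardinal.{u}) (M : ZFSet.{u}) : Prop :=
  IsElementarySub M (H θ) ∧ ∀ z ∈ M, z.card = ℵ_ 1 → IsGuessingModelFor (ℵ_ 1) θ M z

/-- The guessing model property `GMP(μ, κ, θ)`. -/
def GMP (μ κ θ : Cardinal.{u}) : Prop :=
  IsStationary κ (H θ) {M | M ∈ Pk κ (H θ) ∧ IsGuessingModel μ θ M}

/-- For every regular `θ ≥ ω₂`, the models `M ≺ H(θ)` with `|M| < ω₂` that are guessing for sets
of size `ω₁` form a stationary subset of `𝒫_{ω₂} H(θ)`. -/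
def StationarilyManySmallGuessingModels : Prop :=
  ∀ θ : Cardinal.{u}, θ.IsRegular → ℵ_ 2 ≤ θ →
    IsStationary (ℵ_ 2) (H θ)
      {M | M ∈ Pk (ℵ_ 2) (H θ) ∧ IsGuessingModelForSizeOmegaOne θ M}

end SmallGuessing

namespace SmallGuessing

open Cardinal

/-! ### Sets of size less than a regular cardinal -/

universe v

/-! Guessing for a set of size `ω₁` reduces to guessing for `ω₁` itself. Call a model rich if it
contains `ω₁` as an element and as a subset and is closed under intersections and under images and
preimages along fixed enumerations of sets of size `ω₁`. A rich model that approximates `d ⊆ z`,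
with `|z| = ω₁`, has all traces of the preimage of `d` on its countable subsets of `ω₁`, and
contains `d` once it contains the preimage (`IsRich.preimage_inter_mem`,
`IsRich.mem_of_preimage_mem`). Since members of `H(ω₂)` have size at most `ω₁`, this gives the
equivalence; from `GMP` to larger `θ`, the stationary set is lifted by
`IsStationary.exists_inter_mem`.

For `SP → GMP`, suppose that club many models are rich but not guessing. Each such `M` has some `D ⊆
ω₁` outside `M` whose traces on countable members of `M` lie in `M`; for other `M ⊇ ω₁` of size at
most `ω₁`, Cantor's theorem gives some `D ⊆ ω₁` outside `M`. These sets form a slender list. A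
cofinal branch `b` agrees with some `D z` on a set containing `ω₁ ∪ {b ∩ ω₁}`, so `D z = b ∩ ω₁ ∈
z`, a contradiction.

Clubs are handled through functions from finite sets to `𝒫_κ X`: every club contains all `M` closed
under one such function (`IsClub.almostAll`). -/

lemma card_iUnion_lt {κ : Cardinal.{u}} (hκ : κ.IsRegular) {ι : Type v} [Small.{u} ι]
    {f : ι → ZFSet.{u}} (hι : lift.{u} #ι < lift.{v} κ) (hf : ∀ i, (f i).card < κ) :
    (ZFSet.iUnion f).card < κ := by
  have hlt : #(Shrink.{u} ι) < κ := by
    rw [← lift_lt.{u, v}, lift_mk_shrink']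
    exact hι
  have heq : ZFSet.iUnion f = ZFSet.iUnion fun i : Shrink.{u} ι => f ((equivShrink ι).symm i) := by
    ext w
    simp only [ZFSet.mem_iUnion]
    exact (Equiv.exists_congr_left (equivShrink ι))
  rw [heq]
  have h := ZFSet.lift_card_iUnion_le_sum_card
    (f := fun i : Shrink.{u} ι => f ((equivShrink ι).symm i))
  rw [lift_id] at h
  exact h.trans_lt (sum_lt_of_isRegular hκ hlt fun i => hf _)

lemma card_union_lt {κ : Cardinal.{u}} (hκ : ℵ₀ ≤ κ) {x y : ZFSet.{u}} (hx : x.card < κ)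
    (hy : y.card < κ) : (x ∪ y).card < κ :=
  ZFSet.card_union_le.trans_lt (add_lt_of_lt hκ hx hy)

lemma union_mem_Pk {κ : Cardinal.{u}} (hκ : ℵ₀ ≤ κ) {X x y : ZFSet.{u}} (hx : x ∈ Pk κ X)
    (hy : y ∈ Pk κ X) : x ∪ y ∈ Pk κ X := by
  refine ⟨fun a ha => ?_, card_union_lt hκ hx.2 hy.2⟩
  rcases ZFSet.mem_union.1 ha with h | h
  exacts [hx.1 h, hy.1 h]

lemma iUnion_mem_Pk {κ : Cardinal.{u}} (hκ : κ.IsRegular) {X : ZFSet.{u}} {ι : Type v}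
    [Small.{u} ι] {f : ι → ZFSet.{u}} (hι : lift.{u} #ι < lift.{v} κ)
    (hf : ∀ i, f i ∈ Pk κ X) : ZFSet.iUnion f ∈ Pk κ X := by
  refine ⟨fun a ha => ?_, card_iUnion_lt hκ hι fun i => (hf i).2⟩
  obtain ⟨i, hi⟩ := ZFSet.mem_iUnion.1 ha
  exact (hf i).1 hi

lemma sUnion_mem_Pk {κ : Cardinal.{u}} (hκ : κ.IsRegular) {X D : ZFSet.{u}} (hD : D.card < κ)
    (h : ∀ x ∈ D, x ∈ Pk κ X) : ZFSet.sUnion D ∈ Pk κ X := by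
  have hU : ZFSet.sUnion D = ZFSet.iUnion fun x : D => x.1 := by
    ext w
    simp [ZFSet.mem_iUnion]
  rw [hU]
  refine iUnion_mem_Pk hκ ?_ fun x => h x.1 x.2
  simpa [ZFSet.cardinalMk_coe_sort] using hD

lemma range_mem_Pk {κ : Cardinal.{u}} (hκ : ℵ₀ < κ) {X : ZFSet.{u}} {ι : Type v}
    [Countable ι] {f : ι → ZFSet.{u}} (hf : ∀ i, f i ∈ X) : ZFSet.range f ∈ Pk κ X := by
  constructor
  · intro a ha
    obtain ⟨i, rfl⟩ := ZFSet.mem_range.1 ha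
    exact hf i
  · have h := ZFSet.lift_card_range_le (f := f)
    have h2 : lift.{u} #ι ≤ ℵ₀ := lift_le_aleph0.2 (mk_le_aleph0 (α := ι))
    exact (lift_le_aleph0.1 (h.trans h2)).trans_lt hκ

lemma singleton_mem_Pk {κ : Cardinal.{u}} (hκ : ℵ₀ ≤ κ) {X a : ZFSet.{u}} (ha : a ∈ X) :
    {a} ∈ Pk κ X := by
  constructor
  · intro b hb
    rwa [ZFSet.mem_singleton.1 hb]
  · rw [ZFSet.card_singleton]
    exact one_lt_aleph0.trans_le hκ

/-! ### Hulls under set-valued functions on finite sets -/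

/-- A finite set of elements of `x`, given by its image in the small model of `x`. -/
noncomputable def finsetOf (x : ZFSet.{u}) (s : Finset (Shrink.{u} x)) : Finset ZFSet.{u} :=
  s.map ((equivShrink x).symm.toEmbedding.trans (Function.Embedding.subtype _))

lemma mem_finsetOf {x : ZFSet.{u}} {s : Finset (Shrink.{u} x)} {a : ZFSet.{u}} :
    a ∈ finsetOf x s ↔ ∃ h : a ∈ x, equivShrink x ⟨a, h⟩ ∈ s := by
  rw [finsetOf, Finset.mem_map]
  constructor
  · rintro ⟨b, hb, rfl⟩
    refine ⟨((equivShrink x).symm b).2, ?_⟩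
    convert hb
    exact (equivShrink x).apply_symm_apply b
  · rintro ⟨h, hs⟩
    exact ⟨_, hs, congrArg Subtype.val ((equivShrink x).symm_apply_apply ⟨a, h⟩)⟩

lemma finsetOf_subset {x : ZFSet.{u}} (s : Finset (Shrink.{u} x)) : ∀ a ∈ finsetOf x s, a ∈ x := by
  exact fun a ha => (mem_finsetOf.1 ha).1

lemma exists_finsetOf_eq {x : ZFSet.{u}} {e : Finset ZFSet.{u}} (he : ∀ a ∈ e, a ∈ x) :
    ∃ s, finsetOf x s = e := by
  classical
  refine ⟨e.attach.image fun a => equivShrink x ⟨a.1, he a.1 a.2⟩, ?_⟩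
  ext a
  rw [mem_finsetOf]
  constructor
  · rintro ⟨h, hs⟩
    obtain ⟨b, -, hb⟩ := Finset.mem_image.1 hs
    have hba : b.1 = a := Subtype.mk.inj ((equivShrink x).injective hb)
    exact hba ▸ b.2
  · intro ha
    exact ⟨he a ha, Finset.mem_image.2 ⟨⟨a, ha⟩, Finset.mem_attach _ _, rfl⟩⟩

/-- The union of the values of `F` at the finite subsets of `x`. -/
noncomputable def hull (F : Finset ZFSet.{u} → ZFSet.{u}) (x : ZFSet.{u}) : ZFSet.{u} :=
  ZFSet.iUnion fun s : Finset (Shrink.{u} x) => F (finsetOf x s)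

lemma mem_hull {F : Finset ZFSet.{u} → ZFSet.{u}} {x w : ZFSet.{u}} :
    w ∈ hull F x ↔ ∃ e : Finset ZFSet.{u}, (∀ a ∈ e, a ∈ x) ∧ w ∈ F e := by
  rw [hull, ZFSet.mem_iUnion]
  constructor
  · rintro ⟨s, hs⟩
    exact ⟨_, finsetOf_subset s, hs⟩
  · rintro ⟨e, he, hw⟩
    obtain ⟨s, rfl⟩ := exists_finsetOf_eq he
    exact ⟨s, hw⟩

/-- `M` contains the values of `F` at its finite subsets. -/
def IsClosedUnder (F : Finset ZFSet.{u} → ZFSet.{u}) (M : ZFSet.{u}) : Prop :=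
  ∀ e : Finset ZFSet.{u}, (∀ a ∈ e, a ∈ M) → F e ⊆ M

/-- The values of `F` at finite subsets of `X` are in `𝒫_κ X`. -/
def MapsToPk (κ : Cardinal.{u}) (X : ZFSet.{u}) (F : Finset ZFSet.{u} → ZFSet.{u}) : Prop :=
  ∀ e : Finset ZFSet.{u}, (∀ a ∈ e, a ∈ X) → F e ∈ Pk κ X

lemma hull_mono {F : Finset ZFSet.{u} → ZFSet.{u}} {x y : ZFSet.{u}} (h : x ⊆ y) :
    hull F x ⊆ hull F y := by
  intro w hw
  obtain ⟨e, he, hw⟩ := mem_hull.1 hw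
  exact mem_hull.2 ⟨e, fun a ha => h (he a ha), hw⟩

lemma IsClosedUnder.hull_subset {F : Finset ZFSet.{u} → ZFSet.{u}} {M : ZFSet.{u}}
    (h : IsClosedUnder F M) : hull F M ⊆ M := by
  intro w hw
  obtain ⟨e, he, hw⟩ := mem_hull.1 hw
  exact h e he hw

lemma mk_finset_lt {κ : Cardinal.{u}} (hκ : ℵ₀ < κ) {α : Type u} (h : #α < κ) :
    #(Finset α) < κ := by
  cases finite_or_infinite α
  · exact (lt_aleph0_of_finite _).trans hκ
  · rwa [mk_finset_of_infinite]

lemma hull_mem_Pk {κ : Cardinal.{u}} (hκ : κ.IsRegular) (hκ₀ : ℵ₀ < κ) {X : ZFSet.{u}}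
    {F : Finset ZFSet.{u} → ZFSet.{u}} (hF : MapsToPk κ X F) {x : ZFSet.{u}} (hx : x ∈ Pk κ X) :
    hull F x ∈ Pk κ X := by
  refine iUnion_mem_Pk hκ ?_ fun s => hF _ fun a ha => hx.1 (finsetOf_subset s a ha)
  simpa using mk_finset_lt hκ₀ (show #(Shrink.{u} x) < κ from hx.2)

/-- The least superset of `x` that is closed under `F`. -/
noncomputable def closure (F : Finset ZFSet.{u} → ZFSet.{u}) (x : ZFSet.{u}) : ZFSet.{u} :=
  ZFSet.iUnion fun n : ℕ => (fun y => y ∪ hull F y)^[n] x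

lemma subset_closure {F : Finset ZFSet.{u} → ZFSet.{u}} {x : ZFSet.{u}} : x ⊆ closure F x :=
  fun _ ha => ZFSet.mem_iUnion.2 ⟨0, ha⟩

/-- A finite subset of the union of a directed family is a subset of a member of the family. -/
lemma exists_finset_subset {ι : Type v} [Nonempty ι] {A : ι → ZFSet.{u}}
    (hA : ∀ i j, ∃ k, A i ⊆ A k ∧ A j ⊆ A k) (e : Finset ZFSet.{u})
    (he : ∀ a ∈ e, ∃ i, a ∈ A i) : ∃ i, ∀ a ∈ e, a ∈ A i := by
  classical
  induction e using Finset.induction_on with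
  | empty => exact ⟨Classical.arbitrary ι, by simp⟩
  | insert b e _ ih =>
    obtain ⟨i, hi⟩ := ih fun a ha => he a (Finset.mem_insert_of_mem ha)
    obtain ⟨j, hj⟩ := he b (Finset.mem_insert_self b e)
    obtain ⟨k, hik, hjk⟩ := hA i j
    refine ⟨k, fun a ha => ?_⟩
    rcases Finset.mem_insert.1 ha with rfl | h
    exacts [hjk hj, hik (hi a h)]

lemma isClosedUnder_closure (F : Finset ZFSet.{u} → ZFSet.{u}) (x : ZFSet.{u}) :
    IsClosedUnder F (closure F x) := by
  have hmono : Monotone fun n : ℕ => (fun y => y ∪ hull F y)^[n] x := by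
    refine monotone_nat_of_le_succ fun n a ha => ?_
    rw [Function.iterate_succ_apply']
    exact ZFSet.mem_union.2 (Or.inl ha)
  intro e he
  obtain ⟨n, hn⟩ := exists_finset_subset
    (fun i j => ⟨max i j, hmono (le_max_left i j), hmono (le_max_right i j)⟩) e
    fun a ha => ZFSet.mem_iUnion.1 (he a ha)
  intro w hw
  refine ZFSet.mem_iUnion.2 ⟨n + 1, ?_⟩
  rw [Function.iterate_succ_apply']
  exact ZFSet.mem_union.2 (Or.inr (mem_hull.2 ⟨e, hn, hw⟩))

lemma closure_subset {F : Finset ZFSet.{u} → ZFSet.{u}} {x M : ZFSet.{u}} (hx : x ⊆ M)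
    (hM : IsClosedUnder F M) : closure F x ⊆ M := by
  have key : ∀ n : ℕ, (fun y => y ∪ hull F y)^[n] x ⊆ M := by
    intro n
    induction n with
    | zero => exact hx
    | succ n ih =>
      intro w hw
      rw [Function.iterate_succ_apply'] at hw
      rcases ZFSet.mem_union.1 hw with h | h
      exacts [ih h, hM.hull_subset (hull_mono ih h)]
  intro w hw
  obtain ⟨n, hn⟩ := ZFSet.mem_iUnion.1 hw
  exact key n hn

lemma closure_mem_Pk {κ : Cardinal.{u}} (hκ : κ.IsRegular) (hκ₀ : ℵ₀ < κ) {X : ZFSet.{u}}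
    {F : Finset ZFSet.{u} → ZFSet.{u}} (hF : MapsToPk κ X F) {x : ZFSet.{u}} (hx : x ∈ Pk κ X) :
    closure F x ∈ Pk κ X := by
  refine iUnion_mem_Pk hκ (by simpa using hκ₀) fun n => ?_
  induction n with
  | zero => exact hx
  | succ n ih =>
    rw [Function.iterate_succ_apply']
    exact union_mem_Pk hκ₀.le ih (hull_mem_Pk hκ hκ₀ hF ih)

/-! ### Clubs and functions on finite sets -/

lemma isClub_isClosedUnder {κ : Cardinal.{u}} (hκ : κ.IsRegular) (hκ₀ : ℵ₀ < κ) {X : ZFSet.{u}}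
    {F : Finset ZFSet.{u} → ZFSet.{u}} (hF : MapsToPk κ X F) :
    IsClub κ X {M | M ∈ Pk κ X ∧ IsClosedUnder F M} where
  subset _ h := h.1
  closed D hne hD hcard hchain := by
    constructor
    · exact sUnion_mem_Pk hκ hcard fun x hx => (hD x hx).1
    · intro e he
      obtain ⟨x₀, hx₀⟩ := hne
      have : Nonempty D := ⟨⟨x₀, hx₀⟩⟩
      obtain ⟨x, hx⟩ := exists_finset_subset (A := fun x : D => x.1)
        (fun x y => (hchain x.1 x.2 y.1 y.2).elim (fun h => ⟨y, h, fun _ => id⟩)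
          fun h => ⟨x, fun _ => id, h⟩) e
        (fun a ha => by
          obtain ⟨z, hz, haz⟩ := ZFSet.mem_sUnion.1 (he a ha)
          exact ⟨⟨z, hz⟩, haz⟩)
      exact fun w hw => ZFSet.mem_sUnion.2 ⟨x.1, x.2, (hD x.1 x.2).2 e hx hw⟩
  cofinal x hx := ⟨closure F x, ⟨closure_mem_Pk hκ hκ₀ hF hx, isClosedUnder_closure F x⟩,
    subset_closure⟩

lemma IsClub.iUnion_mem {κ : Cardinal.{u}} {X : ZFSet.{u}} {C : Set ZFSet.{u}}
    (hC : IsClub κ X C) {ι : Type u} [Nonempty ι] {A : ι → ZFSet.{u}} (hι : #ι < κ)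
    (hA : ∀ i, A i ∈ C) (hchain : ∀ i j, A i ⊆ A j ∨ A j ⊆ A i) : ZFSet.iUnion A ∈ C := by
  refine hC.closed (ZFSet.range A) ⟨A (Classical.arbitrary ι), by simp⟩ ?_ ?_ ?_
  · intro x hx
    obtain ⟨i, rfl⟩ := ZFSet.mem_range.1 hx
    exact hA i
  · have h := ZFSet.lift_card_range_le (f := A)
    rw [lift_id, lift_id] at h
    exact h.trans_lt hι
  · intro x hx y hy
    obtain ⟨i, rfl⟩ := ZFSet.mem_range.1 hx
    obtain ⟨j, rfl⟩ := ZFSet.mem_range.1 hy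
    exact hchain i j

/-- The finite set `e` as a set. -/
noncomputable def finsetSet (e : Finset ZFSet.{u}) : ZFSet.{u} :=
  ZFSet.range fun a : e => a.1

lemma mem_finsetSet {e : Finset ZFSet.{u}} {a : ZFSet.{u}} : a ∈ finsetSet e ↔ a ∈ e := by
  simp [finsetSet]

lemma finsetSet_mem_Pk {κ : Cardinal.{u}} (hκ : ℵ₀ < κ) {X : ZFSet.{u}} {e : Finset ZFSet.{u}}
    (he : ∀ a ∈ e, a ∈ X) : finsetSet e ∈ Pk κ X :=
  range_mem_Pk hκ fun a => he a.1 a.2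

/-- An element of the set `C` that contains `x`, if there is one. -/
noncomputable def someSuperset (C : Set ZFSet.{u}) (x : ZFSet.{u}) : ZFSet.{u} :=
  open Classical in if h : ∃ y ∈ C, x ⊆ y then h.choose else ∅

lemma IsClub.someSuperset_spec {κ : Cardinal.{u}} {X : ZFSet.{u}} {C : Set ZFSet.{u}}
    (hC : IsClub κ X C) {x : ZFSet.{u}} (hx : x ∈ Pk κ X) :
    someSuperset C x ∈ C ∧ x ⊆ someSuperset C x := by
  have h := hC.cofinal x hx
  rw [someSuperset, dif_pos h]
  exact h.choose_spec

/-- A monotone choice of an element of `C` that contains a given finite set. -/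
noncomputable def clubFun (C : Set ZFSet.{u}) (e : Finset ZFSet.{u}) : ZFSet.{u} :=
  Finset.strongInduction (p := fun _ => ZFSet.{u})
    (fun e f => someSuperset C (finsetSet e ∪ ZFSet.iUnion fun t : {t : e.powerset // t.1 ⊂ e} =>
      f t.1.1 t.2)) e

lemma clubFun_eq (C : Set ZFSet.{u}) (e : Finset ZFSet.{u}) :
    clubFun C e = someSuperset C (finsetSet e ∪ ZFSet.iUnion fun t : {t : e.powerset // t.1 ⊂ e} =>
      clubFun C t.1.1) :=
  Finset.strongInduction_eq _ e

/-- Strong induction is needed because a superset in `C` exists only once the values at the proper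
subsets are known to have a union in `𝒫_κ X`. -/
lemma IsClub.clubFun_spec {κ : Cardinal.{u}} (hκ : κ.IsRegular) (hκ₀ : ℵ₀ < κ) {X : ZFSet.{u}}
    {C : Set ZFSet.{u}} (hC : IsClub κ X C) (e : Finset ZFSet.{u}) (he : ∀ a ∈ e, a ∈ X) :
    clubFun C e ∈ C ∧ (∀ a ∈ e, a ∈ clubFun C e) ∧ ∀ t ⊆ e, clubFun C t ⊆ clubFun C e := by
  induction e using Finset.strongInduction with
  | H e ih =>
    have hmem : finsetSet e ∪ ZFSet.iUnion (fun t : {t : e.powerset // t.1 ⊂ e} => clubFun C t.1.1) ∈ Pk κ X := by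
      refine union_mem_Pk hκ₀.le (finsetSet_mem_Pk hκ₀ he) (iUnion_mem_Pk hκ ?_ fun t => ?_)
      · have h1 : lift.{u} #{t : e.powerset // t.1 ⊂ e} < ℵ₀ := lift_lt_aleph0.2 (lt_aleph0_of_finite _)
        exact h1.trans (by simpa using hκ₀)
      · exact hC.subset (ih t.1.1 t.2 fun a ha => he a (t.2.1 ha)).1
    have hs := hC.someSuperset_spec hmem
    rw [← clubFun_eq] at hs
    refine ⟨hs.1, fun a ha => hs.2 (ZFSet.mem_union.2 (Or.inl (mem_finsetSet.2 ha))), ?_⟩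
    intro t ht
    rcases ht.eq_or_ssubset with rfl | h
    · exact fun _ => id
    · exact fun w hw => hs.2 (ZFSet.mem_union.2 (Or.inr
        (ZFSet.mem_iUnion.2 ⟨⟨⟨t, Finset.mem_powerset.2 ht⟩, h⟩, hw⟩)))

/-- Induction on `|x|` passes from closure under chains to closure under the directed system of
finite subsets. For finite `x` monotonicity makes the hull the single value at `x`; for infinite `x`
the hull is the union of a chain of hulls of smaller sets. -/
lemma IsClub.hull_clubFun_mem {κ : Cardinal.{u}} (hκ : κ.IsRegular) (hκ₀ : ℵ₀ < κ)
    {X : ZFSet.{u}} {C : Set ZFSet.{u}} (hC : IsClub κ X C) {x : ZFSet.{u}} (hx : x ∈ Pk κ X) :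
    hull (clubFun C) x ∈ C := by
  obtain ⟨hxX, hxκ⟩ := hx
  induction hc : x.card using WellFoundedLT.induction generalizing x with
  | ind c ih =>
  rcases lt_or_ge x.card ℵ₀ with hfin | hinf
  · have : Finite (Shrink.{u} x) := lt_aleph0_iff_finite.1 hfin
    have := Fintype.ofFinite (Shrink.{u} x)
    have he := finsetOf_subset (x := x) Finset.univ
    have hall : ∀ a ∈ x, a ∈ finsetOf x Finset.univ := fun a ha =>
      mem_finsetOf.2 ⟨ha, Finset.mem_univ _⟩
    obtain ⟨h1, -, h3⟩ := hC.clubFun_spec hκ hκ₀ _ fun a ha => hxX (he a ha)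
    convert h1 using 1
    ext w
    rw [mem_hull]
    exact ⟨fun ⟨e, hex, hw⟩ => h3 e (fun a ha => hall a (hex a ha)) hw, fun hw => ⟨_, he, hw⟩⟩
  · have := Cardinal.noMaxOrder hinf
    have hne : #x.card.ord.ToType = #(Shrink.{u} x) := by
      rw [mk_ord_toType]
      rfl
    obtain ⟨g⟩ := Cardinal.eq.1 hne
    -- The proper initial segments of `x` in an enumeration of order type `|x|`. The order has no
    -- maximum, so they exhaust `x`.
    let A : x.card.ord.ToType → ZFSet.{u} := fun i =>
      x.sep fun a => ∃ h : a ∈ x, g.symm (equivShrink x ⟨a, h⟩) < i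
    have hAx : ∀ i, A i ⊆ x := fun i => ZFSet.sep_subset
    have hmono : ∀ i j, i ≤ j → A i ⊆ A j := by
      intro i j hij a ha
      obtain ⟨h1, h2, h3⟩ := ZFSet.mem_sep.1 ha
      exact ZFSet.mem_sep.2 ⟨h1, h2, h3.trans_le hij⟩
    have hcard : ∀ i, (A i).card < x.card := by
      intro i
      have hi := mk_Iio_lt i (by simp)
      rw [mk_ord_toType] at hi
      refine lt_of_le_of_lt ?_ hi
      have hinj : Function.Injective fun a : A i =>
          (⟨g.symm (equivShrink x ⟨a.1, hAx i a.2⟩), (ZFSet.mem_sep.1 a.2).2.2⟩ : Set.Iio i) := by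
        intro a b hab
        have h1 := (equivShrink x).injective (g.symm.injective (congrArg Subtype.val hab))
        exact Subtype.ext (Subtype.mk.inj h1)
      have h2 := mk_le_of_injective (hinj.comp (equivShrink (A i)).symm.injective)
      exact h2
    have : Nonempty x.card.ord.ToType := by
      rw [← mk_ne_zero_iff, mk_ord_toType]
      exact (aleph0_pos.trans_le hinf).ne'
    have hU : hull (clubFun C) x = ZFSet.iUnion fun i => hull (clubFun C) (A i) := by
      ext w
      constructor
      · intro hw
        obtain ⟨e, he, hw⟩ := mem_hull.1 hw
        obtain ⟨i, hi⟩ := exists_finset_subset (A := A)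
          (fun i j => ⟨max i j, hmono _ _ (le_max_left i j), hmono _ _ (le_max_right i j)⟩) e
          (fun a ha => by
            obtain ⟨i, hi⟩ := exists_gt (g.symm (equivShrink x ⟨a, he a ha⟩))
            exact ⟨i, ZFSet.mem_sep.2 ⟨he a ha, he a ha, hi⟩⟩)
        exact ZFSet.mem_iUnion.2 ⟨i, mem_hull.2 ⟨e, hi, hw⟩⟩
      · intro hw
        obtain ⟨i, hi⟩ := ZFSet.mem_iUnion.1 hw
        exact hull_mono (hAx i) hi
    rw [hU]
    refine hC.iUnion_mem (by rwa [mk_ord_toType]) (fun i => ?_) fun i j => ?_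
    · exact ih (A i).card (hc ▸ hcard i) (fun a ha => hxX (hAx i ha))
        ((hcard i).trans hxκ) rfl
    · exact (le_total i j).imp (fun h => hull_mono (hmono _ _ h)) fun h => hull_mono (hmono _ _ h)

/-- `P` holds at all members of `𝒫_κ X` that are closed under a suitable function on finite sets. -/
def AlmostAll (κ : Cardinal.{u}) (X : ZFSet.{u}) (P : ZFSet.{u} → Prop) : Prop :=
  ∃ F : Finset ZFSet.{u} → ZFSet.{u}, MapsToPk κ X F ∧ ∀ M ∈ Pk κ X, IsClosedUnder F M → P M

lemma IsClub.almostAll {κ : Cardinal.{u}} (hκ : κ.IsRegular) (hκ₀ : ℵ₀ < κ)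
    {X : ZFSet.{u}} {C : Set ZFSet.{u}} (hC : IsClub κ X C) : AlmostAll κ X fun M => M ∈ C := by
  refine ⟨clubFun C, fun e he => hC.subset (hC.clubFun_spec hκ hκ₀ e he).1, fun M hM hcl => ?_⟩
  -- Closure gives one inclusion, and `a ∈ clubFun C {a}` gives the other.
  have heq : hull (clubFun C) M = M := by
    refine subset_antisymm hcl.hull_subset fun a ha => mem_hull.2 ⟨{a}, by simpa using ha, ?_⟩
    exact (hC.clubFun_spec hκ hκ₀ {a} (by simpa using hM.1 ha)).2.1 a (by simp)
  exact heq ▸ hC.hull_clubFun_mem hκ hκ₀ hM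

lemma AlmostAll.exists_isClub {κ : Cardinal.{u}} (hκ : κ.IsRegular) (hκ₀ : ℵ₀ < κ)
    {X : ZFSet.{u}} {P : ZFSet.{u} → Prop} (h : AlmostAll κ X P) :
    ∃ C, IsClub κ X C ∧ ∀ M ∈ C, P M := by
  obtain ⟨F, hF, hP⟩ := h
  exact ⟨_, isClub_isClosedUnder hκ hκ₀ hF, fun M hM => hP M hM.1 hM.2⟩

lemma AlmostAll.and {κ : Cardinal.{u}} (hκ : ℵ₀ ≤ κ) {X : ZFSet.{u}} {P Q : ZFSet.{u} → Prop}
    (hP : AlmostAll κ X P) (hQ : AlmostAll κ X Q) : AlmostAll κ X fun M => P M ∧ Q M := by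
  obtain ⟨F, hF, hP⟩ := hP
  obtain ⟨G, hG, hQ⟩ := hQ
  refine ⟨fun e => F e ∪ G e, fun e he => union_mem_Pk hκ (hF e he) (hG e he),
    fun M hM h => ⟨hP M hM fun e he w hw => ?_, hQ M hM fun e he w hw => ?_⟩⟩
  · exact h e he (ZFSet.mem_union.2 (Or.inl hw))
  · exact h e he (ZFSet.mem_union.2 (Or.inr hw))

lemma AlmostAll.mono {κ : Cardinal.{u}} {X : ZFSet.{u}} {P Q : ZFSet.{u} → Prop}
    (hP : AlmostAll κ X P) (h : ∀ M ∈ Pk κ X, P M → Q M) : AlmostAll κ X Q := by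
  obtain ⟨F, hF, hP⟩ := hP
  exact ⟨F, hF, fun M hM hcl => h M hM (hP M hM hcl)⟩

lemma almostAll_subset {κ : Cardinal.{u}} {X a : ZFSet.{u}} (ha : a ∈ Pk κ X) :
    AlmostAll κ X fun M => a ⊆ M :=
  ⟨fun _ => a, fun _ _ => ha, fun _ _ h => h ∅ (by simp)⟩

lemma almostAll_mem {κ : Cardinal.{u}} (hκ : ℵ₀ ≤ κ) {X a : ZFSet.{u}} (ha : a ∈ X) :
    AlmostAll κ X fun M => a ∈ M :=
  (almostAll_subset (singleton_mem_Pk hκ ha)).mono fun _ _ h => h (ZFSet.mem_singleton.2 rfl)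

lemma almostAll_op {κ : Cardinal.{u}} (hκ : ℵ₀ < κ) {X : ZFSet.{u}}
    {G : ZFSet.{u} → ZFSet.{u} → ZFSet.{u}} (hG : ∀ a ∈ X, ∀ b ∈ X, G a b ∈ X) :
    AlmostAll κ X fun M => ∀ a ∈ M, ∀ b ∈ M, G a b ∈ M := by
  classical
  refine ⟨fun e => ZFSet.range fun p : e × e => G p.1.1 p.2.1, fun e he => ?_,
    fun M _ h a ha b hb => ?_⟩
  · exact range_mem_Pk hκ fun p => hG _ (he _ p.1.2) _ (he _ p.2.2)
  · refine h {a, b} (by simp [ha, hb]) (ZFSet.mem_range.2 ⟨(⟨a, by simp⟩, ⟨b, by simp⟩), rfl⟩)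

/-- Stationary sets lift from `𝒫_κ X` to `𝒫_κ Y`. -/
lemma IsStationary.exists_inter_mem {κ : Cardinal.{u}} (hκ : κ.IsRegular) (hκ₀ : ℵ₀ < κ)
    {X Y : ZFSet.{u}} (hXY : X ⊆ Y) {S : Set ZFSet.{u}} (hS : IsStationary κ X S)
    {P : ZFSet.{u} → Prop} (hP : AlmostAll κ Y P) : ∃ N ∈ Pk κ Y, P N ∧ N ∩ X ∈ S := by
  obtain ⟨F, hF, hP⟩ := hP
  -- Only the trace of `G` on `X` is seen by `S`. A member `M` of `S` closed under that trace
  -- generates `hull G M`, which adds no new points of `X`.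
  let G : Finset ZFSet.{u} → ZFSet.{u} := fun e => closure F (finsetSet e)
  have hGY : MapsToPk κ Y G := fun e he => closure_mem_Pk hκ hκ₀ hF (finsetSet_mem_Pk hκ₀ he)
  have hGX : MapsToPk κ X fun e => G e ∩ X := by
    intro e he
    refine ⟨fun a ha => (ZFSet.mem_inter.1 ha).2, lt_of_le_of_lt (ZFSet.card_mono ?_)
      (hGY e fun a ha => hXY (he a ha)).2⟩
    exact fun a ha => (ZFSet.mem_inter.1 ha).1
  have hmono : ∀ e e' : Finset ZFSet.{u}, e ⊆ e' → G e ⊆ G e' := fun e e' h =>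
    closure_subset (fun a ha => subset_closure (mem_finsetSet.2 (h (mem_finsetSet.1 ha))))
      (isClosedUnder_closure F _)
  obtain ⟨M, hMS, hMX, hMG⟩ := hS.2 _ (isClub_isClosedUnder hκ hκ₀ hGX)
  have hN : hull G M ∈ Pk κ Y := hull_mem_Pk hκ hκ₀ hGY ⟨fun a ha => hXY (hMX.1 ha), hMX.2⟩
  refine ⟨hull G M, hN, hP _ hN ?_, ?_⟩
  -- The values of `G` at finite subsets of `M` are directed, so a finite subset of the hull lies in
  -- one of them, and that one is closed under `F`.
  · classical
    intro e he
    have : Nonempty {t : Finset ZFSet.{u} // ∀ a ∈ t, a ∈ M} := ⟨⟨∅, by simp⟩⟩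
    obtain ⟨⟨t, ht⟩, h⟩ := exists_finset_subset
      (A := fun t : {t : Finset ZFSet.{u} // ∀ a ∈ t, a ∈ M} => G t.1)
      (hA := fun s t => ⟨⟨s.1 ∪ t.1, fun a ha => (Finset.mem_union.1 ha).elim (s.2 a) (t.2 a)⟩,
        hmono _ _ Finset.subset_union_left, hmono _ _ Finset.subset_union_right⟩) e
      (fun a ha => by
        obtain ⟨t, ht, hat⟩ := mem_hull.1 (he a ha)
        exact ⟨⟨t, ht⟩, hat⟩)
    exact fun w hw => mem_hull.2 ⟨t, ht, isClosedUnder_closure F _ e h hw⟩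
  · convert hMS
    ext a
    rw [ZFSet.mem_inter]
    constructor
    · rintro ⟨ha, haX⟩
      obtain ⟨e, he, hae⟩ := mem_hull.1 ha
      exact hMG e he (ZFSet.mem_inter.2 ⟨hae, haX⟩)
    · exact fun ha => ⟨mem_hull.2 ⟨{a}, by simpa using ha,
        subset_closure (mem_finsetSet.2 (by simp))⟩, hMX.1 ha⟩

lemma isStationary_of_forall_almostAll {κ : Cardinal.{u}} (hκ : κ.IsRegular) (hκ₀ : ℵ₀ < κ)
    {X : ZFSet.{u}} {S : Set ZFSet.{u}} (hS : S ⊆ Pk κ X)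
    (h : ∀ P, AlmostAll κ X P → ∃ M ∈ S, P M) : IsStationary κ X S :=
  ⟨hS, fun _ hC => h _ (hC.almostAll hκ hκ₀)⟩

/-! ### Elementary submodels -/

instance : IsEmpty (Σ n, setLang.Functions n) := ⟨fun f => f.2.elim⟩

instance : Countable setLang.Symbols := by
  have : Countable (Σ n, setLang.Relations n) := by
    have hinj : Function.Injective (Sigma.fst : (Σ n, setLang.Relations n) → ℕ) := by
      rintro ⟨_, ⟨⟩⟩ ⟨_, ⟨⟩⟩ _
      rfl
    exact hinj.countable
  exact inferInstanceAs (Countable ((Σ n, setLang.Functions n) ⊕ (Σ n, setLang.Relations n)))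

instance (n : ℕ) : Countable (setLang.BoundedFormula Empty n) :=
  (sigma_mk_injective (i := n) :
    Function.Injective (Sigma.mk n : setLang.BoundedFormula Empty n → _)).countable

/-- The inclusion of a subset, as an embedding of structures. -/
def inclusion {M X : ZFSet.{u}} (h : M ⊆ X) : setLang.Embedding M X where
  toFun a := ⟨a.1, h a.2⟩
  inj' _ _ hab := Subtype.ext (Subtype.mk.inj hab)
  map_fun' f := f.elim
  map_rel' r := by
    cases r
    exact fun _ => Iff.rfl

/-- The Tarski–Vaught test: there are countably many formulas, so a finite set of parameters
requires only countably many witnesses. -/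
lemma almostAll_isElementarySub {κ : Cardinal.{u}} (hκ : ℵ₀ < κ) {X : ZFSet.{u}}
    (hX : X.Nonempty) : AlmostAll κ X fun M => IsElementarySub M X := by
  classical
  obtain ⟨x₀, hx₀⟩ := hX
  let R (n : ℕ) (φ : setLang.BoundedFormula Empty (n + 1)) (v : Fin n → ZFSet.{u})
      (a : ZFSet.{u}) : Prop :=
    ∃ (y : Fin n → X) (b : X), (∀ i, (y i).1 = v i) ∧ b.1 = a ∧
      φ.Realize default (Fin.snoc y b : _ → X)
  let w (n : ℕ) (φ : setLang.BoundedFormula Empty (n + 1)) (v : Fin n → ZFSet.{u}) : ZFSet.{u} :=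
    -- The default `x₀` keeps the values in `X` when there is no witness.
    if h : ∃ a, R n φ v a then h.choose else x₀
  have hw : ∀ n φ v, w n φ v ∈ X := by
    intro n φ v
    by_cases h : ∃ a, R n φ v a
    · obtain ⟨y, b, -, hb, -⟩ := h.choose_spec
      simp only [w, dif_pos h]
      exact hb ▸ b.2
    · simp only [w, dif_neg h]
      exact hx₀
  refine ⟨fun e => ZFSet.range fun p : Σ n : ℕ,
    setLang.BoundedFormula Empty (n + 1) × (Fin n → e) => w p.1 p.2.1 fun i => (p.2.2 i).1,
    fun e _ => range_mem_Pk hκ fun p => hw _ _ _, fun M hM hcl => ?_⟩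
  refine ⟨(inclusion hM.1).toElementaryEmbedding fun n φ x a ha => ?_, fun _ => rfl⟩
  have hR : ∃ a, R n φ (fun i => (x i).1) a := ⟨a.1, _, a, fun i => rfl, rfl, ha⟩
  have hmem : w n φ (fun i => (x i).1) ∈ M := by
    refine hcl (Finset.univ.image fun i => (x i).1) ?_ (ZFSet.mem_range.2 ⟨⟨n, φ, fun i =>
      ⟨(x i).1, Finset.mem_image_of_mem _ (Finset.mem_univ i)⟩⟩, rfl⟩)
    intro b hb
    obtain ⟨i, -, rfl⟩ := Finset.mem_image.1 hb
    exact (x i).2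
  refine ⟨⟨_, hmem⟩, ?_⟩
  obtain ⟨y, b, hy, hb, hφ⟩ := hR.choose_spec
  have h1 : inclusion hM.1 ∘ x = y := funext fun i => Subtype.ext (hy i).symm
  have h2 : inclusion hM.1 ⟨_, hmem⟩ = b := by
    refine Subtype.ext (Eq.trans ?_ hb.symm)
    change w n φ (fun i => (x i).1) = _
    simp only [w, dif_pos hR]
  rw [h1, h2]
  exact hφ

/-! ### Closure properties of `H(θ)` -/

lemma mem_H_of_subset {θ : Cardinal.{u}} {x y : ZFSet.{u}} (hx : x ∈ H θ) (h : y ⊆ x) :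
    y ∈ H θ := by
  obtain ⟨t, ht, hxt, hc⟩ := mem_H.1 hx
  exact mem_H.2 ⟨t, ht, fun a ha => hxt (h ha), hc⟩

lemma H_mono {θ θ' : Cardinal.{u}} (h : θ ≤ θ') : H θ ⊆ H θ' := by
  intro x hx
  obtain ⟨t, ht, hxt, hc⟩ := mem_H.1 hx
  exact mem_H.2 ⟨t, ht, hxt, hc.trans_le h⟩

lemma isTransitive_H (θ : Cardinal.{u}) : (H θ).IsTransitive := by
  intro x hx a ha
  obtain ⟨t, ht, hxt, hc⟩ := mem_H.1 hx
  exact mem_H.2 ⟨t, ht, ht.subset_of_mem (hxt ha), hc⟩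

lemma card_lt_of_mem_H {θ : Cardinal.{u}} {x : ZFSet.{u}} (hx : x ∈ H θ) : x.card < θ := by
  obtain ⟨t, -, hxt, hc⟩ := mem_H.1 hx
  exact (ZFSet.card_mono hxt).trans_lt hc

/-- Adding to `y` a transitive cover of each of its elements gives a transitive set, which has size
less than `θ` by regularity. -/
lemma mem_H_of_mem_Pk {θ : Cardinal.{u}} (hθ : θ.IsRegular) {y : ZFSet.{u}}
    (hy : y ∈ Pk θ (H θ)) : y ∈ H θ := by
  choose t ht hyt hc using fun w : y => mem_H.1 (hy.1 w.2)
  refine mem_H.2 ⟨y ∪ ZFSet.iUnion t, ?_, fun a ha => ZFSet.mem_union.2 (Or.inl ha),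
    card_union_lt hθ.aleph0_le hy.2 (card_iUnion_lt hθ ?_ hc)⟩
  · intro w hw a ha
    refine ZFSet.mem_union.2 (Or.inr (ZFSet.mem_iUnion.2 ?_))
    rcases ZFSet.mem_union.1 hw with h | h
    · exact ⟨⟨w, h⟩, hyt ⟨w, h⟩ ha⟩
    · obtain ⟨i, hi⟩ := ZFSet.mem_iUnion.1 h
      exact ⟨i, (ht i).mem_trans ha hi⟩
  · simpa [ZFSet.cardinalMk_coe_sort] using hy.2

/-! ### Models with enumerations of the sets of size `ω₁` -/

lemma isRegular_aleph_two : (ℵ_ 2 : Cardinal.{u}).IsRegular := by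
  have h := isRegular_aleph_add_one.{u} 1
  rwa [one_add_one_eq_two] at h

lemma aleph0_lt_aleph_two : ℵ₀ < (ℵ_ 2 : Cardinal.{u}) := by
  simp

lemma aleph_one_lt_aleph_two : (ℵ_ 1 : Cardinal.{u}) < ℵ_ 2 :=
  aleph_lt_aleph.2 (by exact_mod_cast Nat.one_lt_two)

lemma le_aleph_one_of_lt_aleph_two {c : Cardinal.{u}} (h : c < ℵ_ 2) : c ≤ ℵ_ 1 := by
  rw [← one_add_one_eq_two, ← succ_aleph] at h
  exact Order.lt_succ_iff.1 h

/-- The set `ω₁`. -/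
noncomputable def omegaOne : ZFSet.{u} := (ℵ_ 1).ord.toZFSet

lemma card_omegaOne : omegaOne.{u}.card = ℵ_ 1 := by
  rw [omegaOne, Ordinal.card_toZFSet, card_ord]

lemma omegaOne_mem_H {θ : Cardinal.{u}} (hθ : ℵ_ 2 ≤ θ) : omegaOne ∈ H θ :=
  mem_H.2 ⟨omegaOne, (ZFSet.isOrdinal_toZFSet _).isTransitive, fun _ => id,
    card_omegaOne ▸ aleph_one_lt_aleph_two.trans_le hθ⟩

lemma exists_bijOn_of_card_eq {x y : ZFSet.{u}} (h : x.card = y.card) :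
    ∃ g : ZFSet.{u} → ZFSet.{u}, Set.BijOn g x y := by
  classical
  obtain ⟨e⟩ := Cardinal.eq.1 h
  let f : x ≃ y := ((equivShrink x).trans e).trans (equivShrink y).symm
  have hg : ∀ (a) (ha : a ∈ x), (if h : a ∈ x then (f ⟨a, h⟩).1 else ∅) = (f ⟨a, ha⟩).1 :=
    fun a ha => dif_pos ha
  refine ⟨fun a => if h : a ∈ x then (f ⟨a, h⟩).1 else ∅, fun a ha => ?_, fun a ha b hb hab => ?_,
    fun b hb => ?_⟩
  · change (if h : a ∈ x then (f ⟨a, h⟩).1 else ∅) ∈ y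
    rw [hg a ha]
    exact (f ⟨a, ha⟩).2
  · have h1 : (f ⟨a, ha⟩).1 = (f ⟨b, hb⟩).1 := (hg a ha).symm.trans (hab.trans (hg b hb))
    exact Subtype.mk.inj (f.injective (Subtype.ext h1))
  · refine ⟨(f.symm ⟨b, hb⟩).1, (f.symm ⟨b, hb⟩).2, (hg _ (f.symm ⟨b, hb⟩).2).trans ?_⟩
    exact congrArg Subtype.val (f.apply_symm_apply ⟨b, hb⟩)

/-- A function which maps `ω₁` bijectively to `z` if `z` has size `ω₁`. -/
noncomputable def enum (z : ZFSet.{u}) : ZFSet.{u} → ZFSet.{u} :=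
  open Classical in
  if h : ∃ g : ZFSet.{u} → ZFSet.{u}, Set.BijOn g omegaOne z then h.choose else id

lemma bijOn_enum {z : ZFSet.{u}} (hz : z.card = ℵ_ 1) : Set.BijOn (enum z) omegaOne z := by
  have h := exists_bijOn_of_card_eq (card_omegaOne.trans hz.symm)
  rw [enum, dif_pos h]
  exact h.choose_spec

/-- The image of `y` under the enumeration of `z`. -/
noncomputable def enumImage (z y : ZFSet.{u}) : ZFSet.{u} :=
  z.sep fun a => ∃ i ∈ omegaOne, i ∈ y ∧ enum z i = a

/-- The preimage of `e` under the enumeration of `z`. -/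
noncomputable def enumPreimage (z e : ZFSet.{u}) : ZFSet.{u} :=
  omegaOne.sep fun i => enum z i ∈ e

lemma card_enumImage_le (z y : ZFSet.{u}) : (enumImage z y).card ≤ y.card := by
  have hsub : enumImage z y ⊆ ZFSet.range fun i : y => enum z i.1 := by
    intro a ha
    obtain ⟨-, i, -, hi, rfl⟩ := ZFSet.mem_sep.1 ha
    exact ZFSet.mem_range.2 ⟨⟨i, hi⟩, rfl⟩
  have h := ZFSet.lift_card_range_le (f := fun i : y => enum z i.1)
  rw [ZFSet.cardinalMk_coe_sort, lift_lift, lift_le] at h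
  exact (ZFSet.card_mono hsub).trans h

/-- Closure of `M` under intersections and under (pre)images along the enumerations of its
elements. -/
structure IsRich (M : ZFSet.{u}) : Prop where
  mem : omegaOne ∈ M
  subset : omegaOne ⊆ M
  inter : ∀ a ∈ M, ∀ b ∈ M, a ∩ b ∈ M
  image : ∀ z ∈ M, ∀ y ∈ M, enumImage z y ∈ M
  preimage : ∀ z ∈ M, ∀ e ∈ M, enumPreimage z e ∈ M

lemma almostAll_isRich {θ : Cardinal.{u}} (hθ : ℵ_ 2 ≤ θ) : AlmostAll (ℵ_ 2) (H θ) IsRich := by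
  have hκ := aleph0_lt_aleph_two.{u}
  have hΩ := omegaOne_mem_H hθ
  have h1 := almostAll_mem hκ.le hΩ
  have h2 : AlmostAll (ℵ_ 2) (H θ) fun M => omegaOne ⊆ M :=
    almostAll_subset ⟨(isTransitive_H θ).subset_of_mem hΩ, card_omegaOne ▸ aleph_one_lt_aleph_two⟩
  have h3 : AlmostAll (ℵ_ 2) (H θ) fun M => ∀ a ∈ M, ∀ b ∈ M, a ∩ b ∈ M :=
    almostAll_op hκ fun a ha b _ => mem_H_of_subset ha fun _ h => (ZFSet.mem_inter.1 h).1
  have h4 : AlmostAll (ℵ_ 2) (H θ) fun M => ∀ a ∈ M, ∀ b ∈ M, enumImage a b ∈ M :=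
    almostAll_op hκ fun a ha b _ => mem_H_of_subset ha ZFSet.sep_subset
  have h5 : AlmostAll (ℵ_ 2) (H θ) fun M => ∀ a ∈ M, ∀ b ∈ M, enumPreimage a b ∈ M :=
    almostAll_op hκ fun a _ b _ => mem_H_of_subset hΩ ZFSet.sep_subset
  exact ((((h1.and hκ.le h2).and hκ.le h3).and hκ.le h4).and hκ.le h5).mono
    fun M _ h => ⟨h.1.1.1.1, h.1.1.1.2, h.1.1.2, h.1.2, h.2⟩

/-- The image of `y` in `z` is a countable member of `M`, so some `e ∈ M` agrees with `d` on it;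
pulling `e` back gives the trace on `y`. -/
lemma IsRich.preimage_inter_mem {M z d y : ZFSet.{u}} (hM : IsRich M) (hz : z ∈ M)
    (hzc : z.card = ℵ_ 1) (hd : IsApproximated (ℵ_ 1) M z d) (hy : y ∈ M)
    (hyc : y ∈ Pk (ℵ_ 1) omegaOne) : enumPreimage z d ∩ y ∈ M := by
  obtain ⟨e, he, hde⟩ := hd _ (hM.image z hz y hy)
    ⟨ZFSet.sep_subset, (card_enumImage_le z y).trans_lt hyc.2⟩
  have heq : enumPreimage z d ∩ y = enumPreimage z e ∩ y := by
    ext i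
    simp only [ZFSet.mem_inter, enumPreimage, ZFSet.mem_sep]
    refine and_congr_left fun hi => and_congr_right fun hiΩ => ?_
    have himg : enum z i ∈ enumImage z y :=
      ZFSet.mem_sep.2 ⟨(bijOn_enum hzc).mapsTo hiΩ, i, hiΩ, hi, rfl⟩
    have h := ZFSet.ext_iff.1 hde (enum z i)
    simpa only [ZFSet.mem_inter, himg, and_true] using h
  exact heq ▸ hM.inter _ (hM.preimage z hz e he) y hy

lemma IsRich.mem_of_preimage_mem {M z d : ZFSet.{u}} (hM : IsRich M) (hz : z ∈ M)
    (hzc : z.card = ℵ_ 1) (hdz : d ⊆ z) (h : enumPreimage z d ∈ M) : d ∈ M := by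
  have heq : enumImage z (enumPreimage z d) = d := by
    ext a
    simp only [enumImage, enumPreimage, ZFSet.mem_sep]
    constructor
    · rintro ⟨-, i, -, ⟨-, hi⟩, rfl⟩
      exact hi
    · intro ha
      obtain ⟨i, hi, rfl⟩ := (bijOn_enum hzc).surjOn (hdz ha)
      exact ⟨hdz ha, i, hi, ⟨hi, ha⟩, rfl⟩
  exact heq ▸ hM.image z hz _ h

/-- Here `z` itself is an admissible test set, so `d = e ∩ z` for some `e ∈ M`. -/
lemma IsRich.mem_of_isApproximated {M z d : ZFSet.{u}} {μ : Cardinal.{u}} (hM : IsRich M)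
    (hz : z ∈ M) (hzc : z.card < μ) (hdz : d ⊆ z) (hd : IsApproximated μ M z d) : d ∈ M := by
  obtain ⟨e, he, hde⟩ := hd z hz ⟨fun _ => id, hzc⟩
  rw [ZFSet.inter_eq_left_of_subset hdz] at hde
  exact hde ▸ hM.inter e he z hz

/-! ### The equivalence of the two guessing principles -/

lemma IsStationary.exists_mem {κ : Cardinal.{u}} (hκ : κ.IsRegular) (hκ₀ : ℵ₀ < κ)
    {X : ZFSet.{u}} {S : Set ZFSet.{u}} (hS : IsStationary κ X S) {P : ZFSet.{u} → Prop}
    (hP : AlmostAll κ X P) : ∃ M ∈ S, P M := by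
  obtain ⟨C, hC, hCP⟩ := hP.exists_isClub hκ hκ₀
  obtain ⟨M, hMS, hMC⟩ := hS.2 C hC
  exact ⟨M, hMS, hCP M hMC⟩

theorem gmp_of_stationarilyManySmallGuessingModels
    (h : StationarilyManySmallGuessingModels.{u}) : GMP.{u} (ℵ_ 1) (ℵ_ 2) (ℵ_ 2) := by
  refine isStationary_of_forall_almostAll isRegular_aleph_two aleph0_lt_aleph_two
    (fun _ hM => hM.1) fun P hP => ?_
  obtain ⟨M, ⟨hM, hel, hg⟩, hPM, hrich⟩ := (h _ isRegular_aleph_two le_rfl).exists_mem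
    isRegular_aleph_two aleph0_lt_aleph_two (hP.and aleph0_lt_aleph_two.le
      (almostAll_isRich le_rfl))
  refine ⟨M, ⟨hM, hel, fun x hx => ?_⟩, hPM⟩
  rcases (le_aleph_one_of_lt_aleph_two (card_lt_of_mem_H (hM.1 hx))).eq_or_lt with hc | hc
  · exact hg x hx hc
  · exact ⟨hel, hx, fun d hdx hd => ⟨d, hrich.mem_of_isApproximated hx hc hdx hd, rfl⟩⟩

theorem stationarilyManySmallGuessingModels_of_gmp (h : GMP.{u} (ℵ_ 1) (ℵ_ 2) (ℵ_ 2)) :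
    StationarilyManySmallGuessingModels.{u} := by
  intro θ _ hθ
  have hsub := H_mono hθ
  have hκ := aleph0_lt_aleph_two.{u}
  refine isStationary_of_forall_almostAll isRegular_aleph_two hκ
    (fun _ hM => hM.1) fun P hP => ?_
  obtain ⟨N, hN, ⟨⟨hPN, hrich⟩, hel⟩, -, -, hg⟩ := IsStationary.exists_inter_mem
    isRegular_aleph_two hκ hsub h ((hP.and hκ.le (almostAll_isRich hθ)).and hκ.le
      (almostAll_isElementarySub hκ ⟨_, omegaOne_mem_H hθ⟩))
  refine ⟨N, ⟨hN, hel, fun z hz hzc => ⟨hel, hz, fun d hdz hd => ?_⟩⟩, hPN⟩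
  have hΩ := omegaOne_mem_H.{u} le_rfl
  obtain ⟨-, -, hg⟩ := hg omegaOne (ZFSet.mem_inter.2 ⟨hrich.mem, hΩ⟩)
  -- The traces on countable sets lie in `N` by richness and in `H(ω₂)` as subsets of `ω₁`, so `N ∩
  -- H(ω₂)` approximates the preimage.
  obtain ⟨e, he, hde⟩ := hg (enumPreimage z d) ZFSet.sep_subset fun y hy hyc =>
    ⟨enumPreimage z d ∩ y, ZFSet.mem_inter.2
      ⟨hrich.preimage_inter_mem hz hzc hd (ZFSet.mem_inter.1 hy).1 hyc,
        mem_H_of_subset hΩ fun _ h => (ZFSet.mem_sep.1 (ZFSet.mem_inter.1 h).1).1⟩, by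
      ext
      simp⟩
  -- Since `ω₁ ⊆ N ∩ H(ω₂)`, agreement on the model is agreement on all of `ω₁`.
  have heq : enumPreimage z d = e ∩ omegaOne := by
    ext i
    have hi := ZFSet.ext_iff.1 hde i
    simp only [ZFSet.mem_inter] at hi ⊢
    constructor
    · intro hid
      have hiΩ := (ZFSet.mem_sep.1 hid).1
      exact ⟨(hi.1 ⟨hid, hrich.subset hiΩ, (isTransitive_H _).subset_of_mem hΩ hiΩ⟩).1, hiΩ⟩
    · rintro ⟨hie, hiΩ⟩
      exact (hi.2 ⟨hie, hrich.subset hiΩ, (isTransitive_H _).subset_of_mem hΩ hiΩ⟩).1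
  refine ⟨d, hrich.mem_of_preimage_mem hz hzc hdz ?_, rfl⟩
  exact heq ▸ hrich.inter e (ZFSet.mem_inter.1 he).1 _ hrich.mem

/-! ### The slender tree property implies the guessing model property -/

/-- This supplies the clubs in `𝒫_κ H(θ)` that witness slenderness. For cofinality, if `M ∈ C`
contains `x ∩ X`, then `x ∪ M` has trace exactly `M`. -/
lemma IsClub.preimage_inter {κ : Cardinal.{u}} (hκ : κ.IsRegular) {X Y : ZFSet.{u}}
    (hXY : X ⊆ Y) {C : Set ZFSet.{u}} (hC : IsClub κ X C) :
    IsClub κ Y {N | N ∈ Pk κ Y ∧ N ∩ X ∈ C} where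
  subset _ h := h.1
  closed D hne hD hcard hchain := by
    refine ⟨sUnion_mem_Pk hκ hcard fun x hx => (hD x hx).1, ?_⟩
    have hU : ZFSet.sUnion D ∩ X =
        ZFSet.iUnion fun i : Shrink.{u} D => ((equivShrink D).symm i).1 ∩ X := by
      ext a
      simp only [ZFSet.mem_inter, ZFSet.mem_sUnion, ZFSet.mem_iUnion]
      constructor
      · rintro ⟨⟨x, hx, ha⟩, haX⟩
        exact ⟨equivShrink D ⟨x, hx⟩, by simpa using ha, haX⟩
      · rintro ⟨i, ha, haX⟩
        exact ⟨⟨_, ((equivShrink D).symm i).2, ha⟩, haX⟩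
    obtain ⟨x₀, hx₀⟩ := hne
    have : Nonempty (Shrink.{u} D) := ⟨equivShrink D ⟨x₀, hx₀⟩⟩
    rw [hU]
    refine hC.iUnion_mem hcard (fun i => (hD _ ((equivShrink D).symm i).2).2) fun i j => ?_
    refine (hchain _ ((equivShrink D).symm i).2 _ ((equivShrink D).symm j).2).imp ?_ ?_
    all_goals
      intro h a ha
      rw [ZFSet.mem_inter] at ha ⊢
      exact ⟨h ha.1, ha.2⟩
  cofinal x hx := by
    have hxX : x ∩ X ∈ Pk κ X := ⟨fun a ha => (ZFSet.mem_inter.1 ha).2,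
      (ZFSet.card_mono fun a ha => (ZFSet.mem_inter.1 ha).1).trans_lt hx.2⟩
    obtain ⟨M, hM, hxM⟩ := hC.cofinal _ hxX
    have hMX := hC.subset hM
    refine ⟨x ∪ M, ⟨union_mem_Pk hκ.aleph0_le hx ⟨fun a ha => hXY (hMX.1 ha), hMX.2⟩, ?_⟩,
      fun a ha => ZFSet.mem_union.2 (Or.inl ha)⟩
    convert hM
    ext a
    rw [ZFSet.mem_inter, ZFSet.mem_union]
    constructor
    · rintro ⟨h | h, haX⟩
      exacts [hxM (ZFSet.mem_inter.2 ⟨h, haX⟩), h]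
    · exact fun h => ⟨Or.inr h, hMX.1 h⟩

lemma exists_subset_notMem {M x : ZFSet.{u}} (h : M.card < 2 ^ x.card) : ∃ y ⊆ x, y ∉ M := by
  by_contra! hcon
  have hsub : x.powerset ⊆ M := fun y hy => hcon y (ZFSet.mem_powerset.1 hy)
  exact absurd (ZFSet.card_mono hsub) (by rwa [ZFSet.card_powerset, not_le])

/-- A model that is not guessing yields a subset of `ω₁` that it approximates but does not
contain. -/
lemma IsRich.exists_approximated_notMem {M : ZFSet.{u}} (hM : IsRich M)
    (hMH : M ⊆ H (ℵ_ 2)) (hel : IsElementarySub M (H (ℵ_ 2)))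
    (hg : ¬ IsGuessingModel (ℵ_ 1) (ℵ_ 2) M) :
    ∃ D ⊆ omegaOne, D ∉ M ∧ ∀ y ∈ M, y ∈ Pk (ℵ_ 1) omegaOne → D ∩ y ∈ M := by
  refine by_contra fun hcon => hg ⟨hel, fun x hx => ⟨hel, hx, fun d hdx hd => ?_⟩⟩
  refine by_contra fun hng => hcon ?_
  have hdM : d ∉ M := fun h => hng ⟨d, h, rfl⟩
  rcases (le_aleph_one_of_lt_aleph_two (card_lt_of_mem_H (hMH hx))).eq_or_lt with hc | hc
  · exact ⟨enumPreimage x d, ZFSet.sep_subset,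
      fun h => hdM (hM.mem_of_preimage_mem hx hc hdx h),
      fun y hy hyc => hM.preimage_inter_mem hx hc hd hy hyc⟩
  · exact absurd (hM.mem_of_isApproximated hx hc hdx hd) hdM

theorem gmp_of_sp (h : SP.{u} (ℵ_ 1) (ℵ_ 2) (H (ℵ_ 2))) : GMP.{u} (ℵ_ 1) (ℵ_ 2) (ℵ_ 2) := by
  have hκ := aleph0_lt_aleph_two.{u}
  have hΩ := omegaOne_mem_H.{u} le_rfl
  have hΩH := (isTransitive_H _).subset_of_mem hΩ
  refine isStationary_of_forall_almostAll isRegular_aleph_two hκ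
    (fun _ hM => hM.1) fun P hP => ?_
  by_contra! hcon
  obtain ⟨C, hC, hCP⟩ := ((hP.and hκ.le (almostAll_isRich le_rfl)).and hκ.le
    (almostAll_isElementarySub hκ ⟨_, hΩ⟩)).exists_isClub isRegular_aleph_two hκ
  -- The second clause covers every `M ⊇ ω₁`, not only those in `C`, because the `z` provided by a
  -- cofinal branch need not lie in `C`. The third clause yields slenderness.
  have hlist : ∀ M : ZFSet.{u}, ∃ D : ZFSet.{u}, M ∈ Pk (ℵ_ 2) (H (ℵ_ 2)) →
      D ⊆ M ∧ (omegaOne ⊆ M → D ⊆ omegaOne ∧ D ∉ M) ∧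
        (M ∈ C → ∀ y ∈ M, y ∈ Pk (ℵ_ 1) omegaOne → D ∩ y ∈ M) := by
    intro M
    by_cases hMC : M ∈ C
    · obtain ⟨⟨hPM, hrich⟩, hel⟩ := hCP M hMC
      obtain ⟨D, hD, hDM, hDy⟩ := hrich.exists_approximated_notMem (hC.subset hMC).1 hel
        fun hg => hcon M ⟨hC.subset hMC, hg⟩ hPM
      exact ⟨D, fun _ => ⟨fun a ha => hrich.subset (hD ha), fun _ => ⟨hD, hDM⟩, fun _ => hDy⟩⟩
    · by_cases hM : M ∈ Pk (ℵ_ 2) (H (ℵ_ 2)) ∧ omegaOne ⊆ M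
      · obtain ⟨D, hD, hDM⟩ := exists_subset_notMem (M := M) (x := omegaOne) (by
          rw [card_omegaOne]
          exact (le_aleph_one_of_lt_aleph_two hM.1.2).trans_lt (cantor _))
        exact ⟨D, fun _ => ⟨fun a ha => hM.2 (hD ha), fun _ => ⟨hD, hDM⟩, fun h => absurd h hMC⟩⟩
      · exact ⟨∅, fun h => ⟨ZFSet.empty_subset M, fun h' => absurd ⟨h, h'⟩ hM,
          fun h => absurd h hMC⟩⟩
  choose D hD using hlist
  have hslender : IsSlender (ℵ_ 1) (ℵ_ 2) (H (ℵ_ 2)) D := by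
    refine ⟨ℵ_ 2, fun θ hθ => ⟨_, hC.preimage_inter isRegular_aleph_two (H_mono hθ),
      fun N hN y hy hyc => ?_⟩⟩
    have hyH : y ∈ H (ℵ_ 2) :=
      mem_H_of_mem_Pk isRegular_aleph_two ⟨hyc.1, hyc.2.trans aleph_one_lt_aleph_two⟩
    have hyM : y ∈ N ∩ H (ℵ_ 2) := ZFSet.mem_inter.2 ⟨hy, hyH⟩
    obtain ⟨⟨-, hrich⟩, -⟩ := hCP _ hN.2
    obtain ⟨-, hDΩ, hDy⟩ := hD _ (hC.subset hN.2)
    have hmem := hDy hN.2 (y ∩ omegaOne) (hrich.inter y hyM _ hrich.mem)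
      ⟨fun a ha => (ZFSet.mem_inter.1 ha).2,
        (ZFSet.card_mono fun a ha => (ZFSet.mem_inter.1 ha).1).trans_lt hyc.2⟩
    -- Slenderness tests countable `y ⊆ H(ω₂)`, but `D ⊆ ω₁` makes only `y ∩ ω₁` matter.
    have heq : D (N ∩ H (ℵ_ 2)) ∩ (y ∩ omegaOne) = D (N ∩ H (ℵ_ 2)) ∩ y := by
      ext a
      simp only [ZFSet.mem_inter]
      exact ⟨fun h => ⟨h.1, h.2.1⟩, fun h => ⟨h.1, h.2, (hDΩ hrich.subset).1 h.1⟩⟩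
    rw [heq] at hmem
    exact (ZFSet.mem_inter.1 hmem).1
  obtain ⟨b, -, hb⟩ := h D (fun M hM => (hD M hM).1) hslender
  have hbH : b ∩ omegaOne ∈ H (ℵ_ 2) :=
    mem_H_of_subset hΩ fun _ h => (ZFSet.mem_inter.1 h).2
  -- Including `b ∩ ω₁` as an element puts it into `z`; including `ω₁` as a subset makes the branch
  -- determine all of `D z`.
  obtain ⟨z, hz, hxz, hbz⟩ := hb (omegaOne ∪ {b ∩ omegaOne})
    (union_mem_Pk hκ.le ⟨hΩH, card_omegaOne ▸ aleph_one_lt_aleph_two⟩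
      (singleton_mem_Pk hκ.le hbH))
  obtain ⟨hDΩ, hDz⟩ := (hD z hz).2.1 fun a ha => hxz (ZFSet.mem_union.2 (Or.inl ha))
  have heq : b ∩ omegaOne = D z := by
    ext a
    have ha := ZFSet.ext_iff.1 hbz a
    simp only [ZFSet.mem_inter, ZFSet.mem_union] at ha ⊢
    constructor
    · exact fun h => (ha.1 ⟨h.1, Or.inl h.2⟩).1
    · exact fun h => ⟨(ha.2 ⟨h, Or.inl (hDΩ h)⟩).1, hDΩ h⟩
  exact hDz (heq ▸ hxz (ZFSet.mem_union.2 (Or.inr (ZFSet.mem_singleton.2 rfl))))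

end SmallGuessing

/-- `SP(ω₁, ω₂, H(ω₂))` implies that for every regular `θ ≥ ω₂` there are stationarily many models
in `𝒫_{ω₂} H(θ)` that are guessing for sets of size `ω₁`; it implies `GMP(ω₁, ω₂, H(ω₂))`; and
these two conclusions are equivalent to each other. -/
theorem mainTheorem12 :
    (SmallGuessing.SP.{u} (Cardinal.aleph 1) (Cardinal.aleph 2)
        (SmallGuessing.H (Cardinal.aleph 2)) →
      ∀ θ : Cardinal.{u}, θ.IsRegular → Cardinal.aleph 2 ≤ θ →
        SmallGuessing.IsStationary (Cardinal.aleph 2) (SmallGuessing.H θ)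
          {M | M ∈ SmallGuessing.Pk (Cardinal.aleph 2) (SmallGuessing.H θ) ∧
            SmallGuessing.IsGuessingModelForSizeOmegaOne θ M}) ∧
    (SmallGuessing.SP.{u} (Cardinal.aleph 1) (Cardinal.aleph 2)
        (SmallGuessing.H (Cardinal.aleph 2)) →
      SmallGuessing.GMP.{u} (Cardinal.aleph 1) (Cardinal.aleph 2) (Cardinal.aleph 2)) ∧
    (SmallGuessing.StationarilyManySmallGuessingModels.{u} ↔
      SmallGuessing.GMP.{u} (Cardinal.aleph 1) (Cardinal.aleph 2) (Cardinal.aleph 2)) := by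
  exact ⟨fun h => SmallGuessing.stationarilyManySmallGuessingModels_of_gmp
      (SmallGuessing.gmp_of_sp h), SmallGuessing.gmp_of_sp,
    SmallGuessing.gmp_of_stationarilyManySmallGuessingModels,
    SmallGuessing.stationarilyManySmallGuessingModels_of_gmp⟩
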